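/- **Theorem 3.1.** For $n\ge 0$ let $N=2^n$. For a nonempty subset $S\subseteq\{0,1\}^n$ and a function $f:\{0,1\}^n\to\{0,1\}$ let $$|\psi_{f,S}\rangle=\frac1{\sqrt{|S|}}\sum_{x\in S}(-1)^{f(x)}|x\rangle\in\mathbb{C}^N$$ be the associated subset phase state. For $t\ge 0$ and $K\le 2^n$ put $$\rho_{n,t,K}=\mathbb{E}_{S,f}\big[|\psi_{f,S}\rangle\langle\psi_{f,S}|^{\otimes t}\big],\qquad \sigma_{n,t}=\mathbb{E}_{|\phi\rangle}\big[|\phi\rangle\langle\phi|^{\otimes t}\big],$$ where $S$ is uniformly random among the subsets of $\{0,1\}^n$ of size $K$, $f$ is an independent, uniformly random function $\{0,1\}^n\to\{0,1\}$, and $|\phi\rangle$ is Haar random, i.e. uniformly distributed on the unit sphere of $\mathbb{C}^N$. Let $\mathsf{TD}(\rho,\sigma)=\frac12\|\rho-\sigma\|_1$ denote the trace distance. Then: 1. There is a universal constant $C>0$ such that for all integers $n,t,K\ge 0$ with $t<K\le 2^n$, $$\mathsf{TD}(\rho_{n,t,K},\sigma_{n,t})\le C\,\frac{t^2}{K}.$$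 2. Consequently, let $K=K(n)$ and $t=t(n)$ be nonnegative-integer-valued functions such that $K(n)\le 2^n$ for all sufficiently large $n$, $K=2^{\omega(\log n)}$ (that is, $\log n=o(\log_2 K(n))$), and $t$ is bounded by a polynomial in $n$ for all sufficiently large $n$. Then for every real polynomial $q$ with $q(n)>0$ for all sufficiently large $n$, $$\mathsf{TD}(\rho_{n,t(n),K(n)},\sigma_{n,t(n)})<\frac1{q(n)}\qquad\text{for all sufficiently large } n.$$ -/

import Mathlib

open scoped BigOperators

namespace SubsetPhase

/-- `{0,1}^n`, the labels of the computational basis of `n` qubits. -/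
abbrev BitString (n : ℕ) : Type := Fin n → Bool

/-- The space `ℂ^N`, `N = 2^n`, of `n`-qubit state vectors, with its Euclidean norm. -/
abbrev Ket (n : ℕ) : Type := EuclideanSpace ℂ (BitString n)

/-- Operators on `(ℂ^N)^{⊗ t}` as matrices in the product basis `|x_1, …, x_t⟩`. -/
abbrev CopiesOp (n t : ℕ) : Type := Matrix (Fin t → BitString n) (Fin t → BitString n) ℂ

/-- The operator `|ψ⟩⟨ψ|`. -/
noncomputable def ketBra {n : ℕ} (ψ : Ket n) : Matrix (BitString n) (BitString n) ℂ :=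
  Matrix.of fun x y => ψ x * star (ψ y)

/-- The `t`-fold tensor (Kronecker) power `A^{⊗ t}`. -/
noncomputable def tensorPow {n : ℕ} (t : ℕ) (A : Matrix (BitString n) (BitString n) ℂ) :
    CopiesOp n t :=
  Matrix.of fun x y => ∏ i, A (x i) (y i)

/-- The subset phase state `|ψ_{f,S}⟩ = |S|^{-1/2} ∑_{x ∈ S} (-1)^{f(x)} |x⟩`. -/
noncomputable def subsetPhaseState {n : ℕ} (f : BitString n → Bool) (S : Finset (BitString n)) :
    Ket n :=
  (1 / (Real.sqrt (S.card : ℝ) : ℂ)) •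
    ∑ x ∈ S, ((-1 : ℂ) ^ (f x).toNat) • EuclideanSpace.single x (1 : ℂ)

/-- `𝔼_{S, f} |ψ_{f,S}⟩⟨ψ_{f,S}|^{⊗ t}`, with `S` uniform among the subsets of `{0,1}^n` of size `K`
and `f` uniform among all functions `{0,1}^n → {0,1}`, independently of `S`. -/
noncomputable def subsetPhaseMoment (n t K : ℕ) : CopiesOp n t :=
  𝔼 S ∈ Finset.powersetCard K (Finset.univ : Finset (BitString n)),
    𝔼 f : BitString n → Bool, tensorPow t (ketBra (subsetPhaseState f S))

/-- The law of a Haar random state: the uniform probability measure on the unit sphere of `ℂ^N`,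
that is, the surface measure of the sphere (induced by Lebesgue measure), normalized. -/
noncomputable def haarState (n : ℕ) : MeasureTheory.Measure (Metric.sphere (0 : Ket n) 1) :=
  ((MeasureTheory.volume : MeasureTheory.Measure (Ket n)).toSphere Set.univ)⁻¹ •
    (MeasureTheory.volume : MeasureTheory.Measure (Ket n)).toSphere

instance instIsProbabilityMeasureHaarState (n : ℕ) :
    MeasureTheory.IsProbabilityMeasure (haarState n) :=
  ⟨by
    have h : (MeasureTheory.volume : MeasureTheory.Measure (Ket n)).toSphere ≠ 0 :=
      MeasureTheory.Measure.toSphere_ne_zero _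
    simp only [haarState, MeasureTheory.Measure.smul_apply, smul_eq_mul]
    exact ENNReal.inv_mul_cancel (mt MeasureTheory.Measure.measure_univ_eq_zero.1 h)
      (MeasureTheory.measure_ne_top _ _)⟩

/-- The Haar moment operator `𝔼_φ |φ⟩⟨φ|^{⊗ t}` (the expectation is taken entry by entry). -/
noncomputable def haarMoment (n t : ℕ) : CopiesOp n t :=
  Matrix.of fun x y => ∫ φ, tensorPow t (ketBra (φ : Ket n)) x y ∂(haarState n)

/-- The trace norm `‖A‖₁ = Tr √(Aᴴ A)`, the sum of the singular values of `A`. -/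
noncomputable def traceNorm {ι : Type*} [Fintype ι] [DecidableEq ι] (A : Matrix ι ι ℂ) : ℝ :=
  ∑ i, Real.sqrt ((Matrix.isHermitian_conjTranspose_mul_self A).eigenvalues i)

/-- The trace distance `TD(ρ, σ) = ½ ‖ρ - σ‖₁`. -/
noncomputable def traceDist {ι : Type*} [Fintype ι] [DecidableEq ι] (ρ σ : Matrix ι ι ℂ) : ℝ :=
  traceNorm (ρ - σ) / 2

end SubsetPhase

/-! Both laws are invariant under sign changes of single amplitudes and under permutations of the
basis. On the injective tuples (those with distinct entries) this fixes the moment operator up to a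
scalar: sign changes kill every entry pairing an injective tuple with one that is not a
rearrangement of it, and permutations equate all surviving entries. So each moment is `c • E + R`,
with `E = permPattern n t` common to both laws and `R` positive semidefinite, supported on tuples
with a repetition (`exists_smul_permPattern`). The trace of `R` is the probability that `t` samples
drawn from the weights `‖ψ b‖ ^ 2` collide, at most `t ^ 2` times the mean of `∑ b, ‖ψ b‖ ^ 4`. As
both moments have trace one, the coefficients of `E` differ only by what the remainders account for,
and the trace distance is at most the larger remainder trace (`traceDist_stateMoment_le`). It
remains to bound the fourth moments: exactly `1 / K` for subset phase states, and at most `3 / 2 ^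
n` for Haar states, by invariance under a Hadamard rotation of two coordinates. -/

namespace SubsetPhase

open scoped ComplexOrder
open MeasureTheory Matrix

/-! ### Trace norm of Hermitian matrices -/

section TraceNorm

variable {ι : Type*} [Fintype ι] [DecidableEq ι]

/-- The singular values of a Hermitian matrix are the absolute values of its eigenvalues. -/
theorem traceNorm_eq_sum_abs_eigenvalues {A : Matrix ι ι ℂ} (hA : A.IsHermitian) :
    traceNorm A = ∑ i, |hA.eigenvalues i| := by
  have hB := isHermitian_conjTranspose_mul_self A
  have hchar : (Aᴴ * A).charpoly =
      (diagonal fun i => (((hA.eigenvalues i) ^ 2 : ℝ) : ℂ)).charpoly := by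
    have h := hA.spectral_theorem
    rw [Unitary.conjStarAlgAut_apply] at h
    set U : Matrix ι ι ℂ := hA.eigenvectorUnitary.1 with hU
    set D : Matrix ι ι ℂ := diagonal (RCLike.ofReal ∘ hA.eigenvalues) with hD
    have hUU : star U * U = 1 := Unitary.coe_star_mul_self hA.eigenvectorUnitary
    have hDD : D * D = diagonal fun i => (((hA.eigenvalues i) ^ 2 : ℝ) : ℂ) := by
      rw [hD, diagonal_mul_diagonal]
      congr 1
      ext i
      simp [sq]
    have h2 : A * A = U * (D * D * star U) := by
      conv_lhs => rw [h]
      calc U * D * star U * (U * D * star U) = U * D * (star U * U) * D * star U := by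
            simp only [Matrix.mul_assoc]
        _ = U * (D * D * star U) := by rw [hUU]; simp only [Matrix.mul_assoc, Matrix.mul_one]
    rw [hA.eq, h2, charpoly_mul_comm, Matrix.mul_assoc, hUU, Matrix.mul_one, hDD]
  have hroots : Multiset.map (RCLike.ofReal ∘ hB.eigenvalues) Finset.univ.val =
      Multiset.map (fun i => (((hA.eigenvalues i) ^ 2 : ℝ) : ℂ)) Finset.univ.val := by
    rw [← hB.roots_charpoly_eq_eigenvalues, hchar, charpoly_diagonal, Polynomial.roots_prod]
    · simp only [Polynomial.roots_X_sub_C, Multiset.bind_singleton]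
    · exact Finset.prod_ne_zero_iff.2 fun _ _ => Polynomial.X_sub_C_ne_zero _
  -- The two eigenvalue families agree only as multisets, so they are compared through a symmetric
  -- function.
  have hsum := congrArg (fun s : Multiset ℂ => (s.map fun z => Real.sqrt z.re).sum) hroots
  simp only [Multiset.map_map] at hsum
  unfold traceNorm
  calc _ = (Multiset.map ((fun z : ℂ => Real.sqrt z.re) ∘ (RCLike.ofReal ∘ hB.eigenvalues))
        Finset.univ.val).sum := rfl
    _ = _ := hsum
    _ = ∑ i, Real.sqrt ((hA.eigenvalues i) ^ 2) := rfl
    _ = _ := by simp only [Real.sqrt_sq_eq_abs]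

/-- In an eigenbasis of `A`, positivity of `P ± A` makes each diagonal entry of `P` dominate the
absolute value of the matching eigenvalue; the trace does not depend on the basis. -/
theorem traceNorm_le_trace {A P : Matrix ι ι ℂ} (hA : A.IsHermitian)
    (h₁ : (P - A).PosSemidef) (h₂ : (P + A).PosSemidef) : traceNorm A ≤ P.trace.re := by
  rw [traceNorm_eq_sum_abs_eigenvalues hA]
  set U : Matrix ι ι ℂ := hA.eigenvectorUnitary.1 with hU
  have hUU : U * star U = 1 := Unitary.coe_mul_star_self hA.eigenvectorUnitary
  have hAU : Uᴴ * A * U = diagonal (RCLike.ofReal ∘ hA.eigenvalues) := by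
    have h := hA.conjStarAlgAut_star_eigenvectorUnitary
    rwa [Unitary.conjStarAlgAut_star_apply] at h
  have htr : P.trace = (Uᴴ * P * U).trace := by
    rw [trace_mul_cycle, ← star_eq_conjTranspose, hUU, Matrix.one_mul]
  rw [htr, trace, Complex.re_sum]
  refine Finset.sum_le_sum fun i _ => ?_
  have g₁ := (h₁.conjTranspose_mul_mul_same U).diag_nonneg (i := i)
  have g₂ := (h₂.conjTranspose_mul_mul_same U).diag_nonneg (i := i)
  rw [Matrix.mul_sub, Matrix.sub_mul, hAU, Matrix.sub_apply, diagonal_apply_eq] at g₁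
  rw [Matrix.mul_add, Matrix.add_mul, hAU, Matrix.add_apply, diagonal_apply_eq] at g₂
  have k₁ := (Complex.le_def.1 g₁).1
  have k₂ := (Complex.le_def.1 g₂).1
  simp at k₁ k₂
  rw [abs_le]
  simp only [diag_apply]
  constructor <;> linarith

end TraceNorm

/-! ### Collision probability of independent samples -/

section Collision

variable {β : Type*} [Fintype β] [DecidableEq β]

/-- Splitting by the common value `b` makes the sum factor over coordinates: `i` and `j` contribute
`w b` each, every other coordinate contributes one. -/
theorem sum_prod_ite_eq {t : ℕ} (w : β → ℝ) (hw : ∑ b, w b = 1) {i j : Fin t} (hij : i ≠ j) :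
    ∑ x : Fin t → β, (if x i = x j then ∏ k, w (x k) else 0) = ∑ b, w b ^ 2 := by
  have h : ∀ x : Fin t → β, (if x i = x j then ∏ k, w (x k) else 0) =
      ∑ b, ∏ k, if k = i ∨ k = j then (if x k = b then w (x k) else 0) else w (x k) := by
    intro x
    split_ifs with hx
    · rw [Finset.sum_eq_single (x i)]
      · refine Finset.prod_congr rfl fun k _ => ?_
        split_ifs with h1 h2
        · rfl
        · rcases h1 with rfl | rfl
          · exact absurd rfl h2
          · exact absurd hx.symm h2
        · rfl
      · intro b _ hb
        refine Finset.prod_eq_zero (Finset.mem_univ i) ?_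
        simp [hb.symm]
      · simp
    · symm
      refine Finset.sum_eq_zero fun b _ => ?_
      by_cases hb : x i = b
      · refine Finset.prod_eq_zero (Finset.mem_univ j) ?_
        have : x j ≠ b := fun h => hx (hb.trans h.symm)
        simp [this]
      · refine Finset.prod_eq_zero (Finset.mem_univ i) ?_
        simp [hb]
  simp_rw [h]
  rw [Finset.sum_comm]
  refine Finset.sum_congr rfl fun b _ => ?_
  have := (Finset.prod_univ_sum (fun _ : Fin t => (Finset.univ : Finset β))
    (fun k a => if k = i ∨ k = j then (if a = b then w a else 0) else w a)).symm
  rw [Fintype.piFinset_univ] at this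
  rw [this]
  have h2 : ∀ k : Fin t, (∑ a, if k = i ∨ k = j then (if a = b then w a else 0) else w a) =
      if k ∈ ({i, j} : Finset (Fin t)) then w b else 1 := by
    intro k
    by_cases hk : k = i ∨ k = j
    · simp [hk]
    · simp [hk, hw]
  simp_rw [h2]
  rw [Finset.prod_ite_mem, Finset.univ_inter, Finset.prod_const, Finset.card_pair hij]

/-- The birthday bound for `t` independent samples of a probability vector `w`. -/
theorem one_sub_sum_injective_le {t : ℕ} (w : β → ℝ) (h0 : ∀ b, 0 ≤ w b) (hw : ∑ b, w b = 1) :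
    1 - ∑ x : Fin t → β, (if Function.Injective x then ∏ k, w (x k) else 0) ≤
      (t : ℝ) ^ 2 * ∑ b, w b ^ 2 := by
  have htot : ∑ x : Fin t → β, ∏ k, w (x k) = 1 := by
    have := (Finset.prod_univ_sum (fun _ : Fin t => (Finset.univ : Finset β))
      (fun _ a => w a)).symm
    rw [Fintype.piFinset_univ] at this
    rw [this]
    simp [hw]
  rw [← htot, ← Finset.sum_sub_distrib]
  -- Union bound over ordered pairs, which is cruder than necessary but gives the clean factor `t ^
  -- 2`.
  calc _ ≤ ∑ x : Fin t → β, ∑ i : Fin t, ∑ j : Fin t,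
        (if i ≠ j then (if x i = x j then ∏ k, w (x k) else 0) else 0) := by
        refine Finset.sum_le_sum fun x _ => ?_
        have hp : 0 ≤ ∏ k, w (x k) := Finset.prod_nonneg fun k _ => h0 _
        have hnn : ∀ i j : Fin t,
            0 ≤ (if i ≠ j then (if x i = x j then ∏ k, w (x k) else 0) else 0) := by
          intro i j
          split_ifs <;> first | exact hp | exact le_rfl
        split_ifs with hx
        · rw [sub_self]
          exact Finset.sum_nonneg fun i _ => Finset.sum_nonneg fun j _ => hnn i j
        · simp only [Function.Injective] at hx
          push Not at hx
          obtain ⟨i, j, hxij, hij⟩ := hx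
          calc _ = (if i ≠ j then (if x i = x j then ∏ k, w (x k) else 0) else 0) := by
                simp [hij, hxij]
            _ ≤ ∑ j : Fin t,
                (if i ≠ j then (if x i = x j then ∏ k, w (x k) else 0) else 0) :=
                Finset.single_le_sum (f := fun j =>
                  (if i ≠ j then (if x i = x j then ∏ k, w (x k) else 0) else 0))
                  (fun j _ => hnn i j) (Finset.mem_univ j)
            _ ≤ _ := Finset.single_le_sum (f := fun i => ∑ j : Fin t,
                  (if i ≠ j then (if x i = x j then ∏ k, w (x k) else 0) else 0))
                  (fun i _ => Finset.sum_nonneg fun j _ => hnn i j) (Finset.mem_univ i)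
    _ = ∑ i : Fin t, ∑ j : Fin t, if i ≠ j then ∑ b, w b ^ 2 else 0 := by
        rw [Finset.sum_comm]
        refine Finset.sum_congr rfl fun i _ => ?_
        rw [Finset.sum_comm]
        refine Finset.sum_congr rfl fun j _ => ?_
        by_cases hij : i = j
        · simp [hij]
        · simp only [ne_eq, hij, not_false_eq_true, if_true]
          exact sum_prod_ite_eq w hw hij
    _ ≤ ∑ _i : Fin t, ∑ _j : Fin t, ∑ b, w b ^ 2 := by
        refine Finset.sum_le_sum fun i _ => Finset.sum_le_sum fun j _ => ?_
        split_ifs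
        · exact le_rfl
        · exact Finset.sum_nonneg fun b _ => sq_nonneg _
    _ = _ := by simp [sq, mul_assoc]

end Collision

/-! ### Moments of laws invariant under signed permutations -/

section InvariantLaw

variable {n : ℕ}

/-- The isometry changing the sign of the amplitude at `b`. -/
noncomputable def signFlip (b : BitString n) : Ket n ≃ₗᵢ[ℝ] Ket n :=
  LinearIsometryEquiv.piLpCongrRight 2 fun x =>
    if x = b then LinearIsometryEquiv.neg ℝ else LinearIsometryEquiv.refl ℝ ℂ

theorem signFlip_apply (b : BitString n) (ψ : Ket n) (x : BitString n) :
    signFlip b ψ x = (if x = b then -1 else 1) * ψ x := by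
  simp only [signFlip, LinearIsometryEquiv.piLpCongrRight_apply]
  split_ifs <;> simp

/-- The isometry permuting the basis states by `e`. -/
noncomputable def permute (e : Equiv.Perm (BitString n)) : Ket n ≃ₗᵢ[ℝ] Ket n :=
  LinearIsometryEquiv.piLpCongrLeft 2 ℝ ℂ e

theorem permute_apply (e : Equiv.Perm (BitString n)) (ψ : Ket n) (x : BitString n) :
    permute e ψ x = ψ (e.symm x) := by
  simp [permute, LinearIsometryEquiv.piLpCongrLeft_apply, Equiv.piCongrLeft']

/-- A law of random states that is invariant under signed permutations of the basis states. -/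
structure IsSignedPermInvariant (ν : Measure (Ket n)) : Prop where
  norm_eq_one : ∀ᵐ ψ ∂ν, ‖ψ‖ = 1
  signFlip : ∀ b, MeasurePreserving (signFlip b) ν ν
  permute : ∀ e, MeasurePreserving (permute e) ν ν

/-- The `t`-th moment operator of the law `ν`. -/
noncomputable def stateMoment (ν : Measure (Ket n)) (t : ℕ) : CopiesOp n t :=
  Matrix.of fun x y => ∫ ψ, tensorPow t (ketBra ψ) x y ∂ν

theorem tensorPow_ketBra_apply {t : ℕ} (ψ : Ket n) (x y : Fin t → BitString n) :
    tensorPow t (ketBra ψ) x y = ∏ i, ψ (x i) * star (ψ (y i)) := rfl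

theorem tensorPow_ketBra_eq {t : ℕ} (ψ : Ket n) :
    tensorPow t (ketBra ψ) =
      vecMulVec (fun x => ∏ i, ψ (x i)) (star fun x : Fin t → BitString n => ∏ i, ψ (x i)) := by
  ext x y
  simp [tensorPow_ketBra_apply, vecMulVec_apply, Finset.prod_mul_distrib]

theorem tensorPow_ketBra_self {t : ℕ} (ψ : Ket n) (x : Fin t → BitString n) :
    tensorPow t (ketBra ψ) x x = ((∏ i, ‖ψ (x i)‖ ^ 2 : ℝ) : ℂ) := by
  rw [tensorPow_ketBra_apply, Complex.ofReal_prod]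
  refine Finset.prod_congr rfl fun i _ => ?_
  rw [← starRingEnd_apply, Complex.mul_conj, Complex.normSq_eq_norm_sq]

theorem continuous_tensorPow_ketBra {t : ℕ} (x y : Fin t → BitString n) :
    Continuous fun ψ : Ket n => tensorPow t (ketBra ψ) x y := by
  simp only [tensorPow_ketBra_apply]
  fun_prop

theorem sum_norm_sq {ψ : Ket n} (h : ‖ψ‖ = 1) : ∑ x, ‖ψ x‖ ^ 2 = 1 := by
  rw [← EuclideanSpace.norm_sq_eq, h, one_pow]

variable {ν : Measure (Ket n)}

theorem exists_perm_of_range_eq {t : ℕ} {β : Type*} {x y : Fin t → β}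
    (hx : Function.Injective x) (hy : Function.Injective y) (h : Set.range x = Set.range y) :
    ∃ π : Equiv.Perm (Fin t), ∀ i, x (π i) = y i := by
  refine ⟨(Equiv.ofInjective y hy).trans ((Equiv.setCongr h.symm).trans
    (Equiv.ofInjective x hx).symm), fun i => ?_⟩
  simp [Equiv.apply_ofInjective_symm]

/-- Such `x` and `y` differ by a reordering of the `t` copies, under which the product of amplitudes
is unchanged. -/
theorem stateMoment_apply_of_range_eq {t : ℕ} {x y : Fin t → BitString n}
    (hx : Function.Injective x) (hy : Function.Injective y) (h : Set.range x = Set.range y) :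
    stateMoment ν t x y = stateMoment ν t x x := by
  obtain ⟨π, hπ⟩ := exists_perm_of_range_eq hx hy h
  simp only [stateMoment, of_apply]
  congr 1
  ext ψ
  simp only [tensorPow_ketBra_apply, Finset.prod_mul_distrib, ← hπ]
  rw [Equiv.prod_comp π fun i => star (ψ (x i))]

/-- Otherwise the range of `x`, which has `t` elements, lies in that of `y`, which has at most `t`;
they coincide and `y` is injective. -/
theorem exists_notMem_range {t : ℕ} {β : Type*} {x y : Fin t → β}
    (hx : Function.Injective x) (h : ¬ (Function.Injective y ∧ Set.range x = Set.range y)) :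
    ∃ i, x i ∉ Set.range y := by
  classical
  by_contra! hc
  have hsub : Finset.univ.image x ⊆ Finset.univ.image y := by
    intro b hb
    obtain ⟨i, -, rfl⟩ := Finset.mem_image.1 hb
    obtain ⟨j, hj⟩ := hc i
    exact Finset.mem_image.2 ⟨j, Finset.mem_univ j, hj⟩
  have hcard : (Finset.univ.image y).card ≤ (Finset.univ.image x).card := by
    rw [Finset.card_image_of_injective _ hx]
    exact Finset.card_image_le
  have heq := Finset.eq_of_subset_of_card_le hsub hcard
  refine h ⟨?_, ?_⟩
  · refine Set.injOn_univ.1 ?_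
    rw [← Finset.coe_univ]
    refine Finset.card_image_iff.1 ?_
    rw [← heq, Finset.card_image_of_injective _ hx]
  · simpa using congrArg (fun s : Finset β => (s : Set β)) heq

/-- Flip the sign at a label occurring once in `x` and never in `y`: the integrand is negated while
the law is preserved. -/
theorem stateMoment_apply_eq_zero (hν : IsSignedPermInvariant ν) {t : ℕ}
    {x y : Fin t → BitString n} (hx : Function.Injective x)
    (h : ¬ (Function.Injective y ∧ Set.range x = Set.range y)) :
    stateMoment ν t x y = 0 := by
  obtain ⟨i, hi⟩ := exists_notMem_range hx h
  have hflip : ∀ ψ : Ket n, tensorPow t (ketBra (signFlip (x i) ψ)) x y =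
      - tensorPow t (ketBra ψ) x y := by
    intro ψ
    simp only [tensorPow_ketBra_apply, signFlip_apply, Finset.prod_mul_distrib, star_mul']
    have h1 : ∏ k, (if x k = x i then (-1 : ℂ) else 1) = -1 := by
      simp [hx.eq_iff]
    have h2 : ∀ k, y k ≠ x i := fun k hk => hi ⟨k, hk⟩
    simp [h1, h2]
  have hint := (hν.signFlip (x i)).integral_comp
    (signFlip (x i)).toHomeomorph.measurableEmbedding (fun ψ => tensorPow t (ketBra ψ) x y)
  simp only [hflip, integral_neg] at hint
  exact self_eq_neg.1 hint.symm

/-- The symmetric group acts transitively on injective `t`-tuples of labels. -/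
theorem stateMoment_self_eq (hν : IsSignedPermInvariant ν) {t : ℕ}
    {x y : Fin t → BitString n} (hx : Function.Injective x) (hy : Function.Injective y) :
    stateMoment ν t x x = stateMoment ν t y y := by
  have := Equiv.Perm.isMultiplyPretransitive (BitString n) t
  obtain ⟨e, he⟩ := MulAction.exists_smul_eq (Equiv.Perm (BitString n))
    (⟨y, hy⟩ : Fin t ↪ BitString n) ⟨x, hx⟩
  have he' : ∀ i, e.symm (x i) = y i := fun i => by
    rw [Equiv.symm_apply_eq]
    exact (DFunLike.congr_fun he i).symm
  have hint := (hν.permute e).integral_comp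
    (permute e).toHomeomorph.measurableEmbedding (fun ψ => tensorPow t (ketBra ψ) x x)
  simp only [stateMoment, of_apply]
  rw [← hint]
  simp only [tensorPow_ketBra_apply, permute_apply, he']

variable [IsProbabilityMeasure ν]

/-- The law lives on the unit sphere, which is compact, so continuous functions are essentially
bounded. -/
theorem integrable_of_norm_eq_one {E : Type*} [NormedAddCommGroup E] [SecondCountableTopology E]
    (hν : ∀ᵐ ψ ∂ν, ‖ψ‖ = 1) {f : Ket n → E} (hf : Continuous f) : Integrable f ν := by
  obtain ⟨C, hC⟩ := (isCompact_sphere (0 : Ket n) 1).exists_bound_of_continuousOn hf.continuousOn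
  refine Integrable.of_bound hf.aestronglyMeasurable C ?_
  filter_upwards [hν] with ψ h
  exact hC ψ (by simpa using h)

theorem stateMoment_posSemidef (hν : ∀ᵐ ψ ∂ν, ‖ψ‖ = 1) (t : ℕ) :
    (stateMoment ν t).PosSemidef := by
  have hpos : ∀ ψ : Ket n, (tensorPow t (ketBra ψ)).PosSemidef := fun ψ => by
    rw [tensorPow_ketBra_eq]
    exact posSemidef_vecMulVec_self_star _
  refine PosSemidef.of_dotProduct_mulVec_nonneg ?_ fun v => ?_
  · ext x y
    simp only [conjTranspose_apply, stateMoment, of_apply]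
    rw [← starRingEnd_apply, ← integral_conj]
    congr 1
    ext ψ
    exact (hpos ψ).isHermitian.apply x y
  · have h : star v ⬝ᵥ (stateMoment ν t) *ᵥ v =
        ∫ ψ, star v ⬝ᵥ (tensorPow t (ketBra ψ)) *ᵥ v ∂ν := by
      simp only [dotProduct, mulVec, Finset.mul_sum]
      have hint : ∀ x y, Integrable
          (fun ψ : Ket n => star v x * (tensorPow t (ketBra ψ) x y * v y)) ν := fun x y =>
        integrable_of_norm_eq_one hν
          (continuous_const.mul ((continuous_tensorPow_ketBra x y).mul continuous_const))
      rw [integral_finsetSum _ fun x _ => integrable_finsetSum _ fun y _ => hint x y]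
      refine Finset.sum_congr rfl fun x _ => ?_
      rw [integral_finsetSum _ fun y _ => hint x y]
      refine Finset.sum_congr rfl fun y _ => ?_
      rw [integral_const_mul, integral_mul_const]
      rfl
    rw [h]
    exact integral_nonneg fun ψ => (hpos ψ).dotProduct_mulVec_nonneg v

theorem trace_stateMoment (hν : ∀ᵐ ψ ∂ν, ‖ψ‖ = 1) (t : ℕ) : (stateMoment ν t).trace = 1 := by
  have h : (stateMoment ν t).trace =
      ∫ ψ, ∑ x : Fin t → BitString n, tensorPow t (ketBra ψ) x x ∂ν := by
    rw [integral_finsetSum _ fun x _ =>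
      integrable_of_norm_eq_one hν (continuous_tensorPow_ketBra x x)]
    rfl
  have h1 : ∀ᵐ ψ ∂ν, ∑ x : Fin t → BitString n, tensorPow t (ketBra ψ) x x = 1 := by
    filter_upwards [hν] with ψ hψ
    simp only [tensorPow_ketBra_self]
    rw [← Complex.ofReal_sum]
    have := (Finset.prod_univ_sum (fun _ : Fin t => (Finset.univ : Finset (BitString n)))
      (fun _ a => ‖ψ a‖ ^ 2)).symm
    rw [Fintype.piFinset_univ] at this
    rw [this]
    simp [sum_norm_sq hψ]
  rw [h, integral_congr_ae h1]
  simp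

/-- The pairs of injective tuples that are permutations of one another. -/
noncomputable def permPattern (n t : ℕ) : CopiesOp n t :=
  Matrix.of fun x y => open Classical in
    if Function.Injective x ∧ Function.Injective y ∧ Set.range x = Set.range y then 1 else 0

/-- It is a sum over label sets `s` of rank-one matrices, each built from the indicator of the
injective tuples with range `s`. -/
theorem permPattern_posSemidef (n t : ℕ) : (permPattern n t).PosSemidef := by
  classical
  have h : permPattern n t = ∑ s : Set (BitString n), vecMulVec
      (fun x => if Function.Injective x ∧ Set.range x = s then 1 else 0)
      (star fun x : Fin t → BitString n =>
        if Function.Injective x ∧ Set.range x = s then (1 : ℂ) else 0) := by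
    ext x y
    rw [Matrix.sum_apply]
    simp only [permPattern, of_apply, vecMulVec_apply, Pi.star_apply]
    rw [Finset.sum_eq_single (Set.range x)]
    · by_cases hx : Function.Injective x <;> by_cases hy : Function.Injective y <;>
        simp [hx, hy, eq_comm]
    · intro s _ hs
      simp [hs.symm]
    · simp
  rw [h]
  exact posSemidef_sum _ fun s _ => posSemidef_vecMulVec_self_star _

/-- For a unit vector the weights `‖ψ b‖ ^ 2` form a probability vector; this is the birthday bound
averaged over `ψ`. -/
theorem sum_injective_stateMoment_ge (hν : ∀ᵐ ψ ∂ν, ‖ψ‖ = 1) (t : ℕ) :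
    1 - ∑ x : Fin t → BitString n, (open Classical in
      if Function.Injective x then (stateMoment ν t x x).re else 0) ≤
      (t : ℝ) ^ 2 * ∫ ψ, ∑ b, ‖ψ b‖ ^ 4 ∂ν := by
  classical
  have hre : ∀ x : Fin t → BitString n,
      (stateMoment ν t x x).re = ∫ ψ, ∏ i, ‖ψ (x i)‖ ^ 2 ∂ν := by
    intro x
    simp only [stateMoment, of_apply, tensorPow_ketBra_self]
    rw [integral_complex_ofReal, Complex.ofReal_re]
  have hint : ∀ x : Fin t → BitString n, Integrable (fun ψ : Ket n =>
      if Function.Injective x then ∏ i, ‖ψ (x i)‖ ^ 2 else 0) ν := by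
    intro x
    split_ifs
    · exact integrable_of_norm_eq_one hν (by fun_prop)
    · exact integrable_zero _ _ _
  have hsum : ∑ x : Fin t → BitString n,
      (if Function.Injective x then (stateMoment ν t x x).re else 0) =
      ∫ ψ, ∑ x : Fin t → BitString n,
        (if Function.Injective x then ∏ i, ‖ψ (x i)‖ ^ 2 else 0) ∂ν := by
    rw [integral_finsetSum _ fun x _ => hint x]
    refine Finset.sum_congr rfl fun x _ => ?_
    split_ifs
    · exact hre x
    · simp
  have hone : (1 : ℝ) = ∫ _ψ, (1 : ℝ) ∂ν := by simp
  rw [hsum, hone, ← integral_sub (integrable_const _) (integrable_finsetSum _ fun x _ => hint x),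
    ← integral_const_mul]
  refine integral_mono_ae
    ((integrable_const _).sub (integrable_finsetSum _ fun x _ => hint x))
    (integrable_of_norm_eq_one hν (by fun_prop)) ?_
  filter_upwards [hν] with ψ hψ
  have := one_sub_sum_injective_le (t := t) (fun b => ‖ψ b‖ ^ 2) (fun b => by positivity)
    (sum_norm_sq hψ)
  simpa only [← pow_mul] using this

theorem exists_smul_permPattern (hν : IsSignedPermInvariant ν) (t : ℕ) :
    ∃ c : ℝ, (stateMoment ν t - (c : ℂ) • permPattern n t).PosSemidef ∧
      1 - c * (permPattern n t).trace.re ≤ (t : ℝ) ^ 2 * ∫ ψ, ∑ b, ‖ψ b‖ ^ 4 ∂ν := by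
  classical
  have hpsd := stateMoment_posSemidef hν.norm_eq_one t
  obtain ⟨c, hc⟩ : ∃ c : ℝ, ∀ x : Fin t → BitString n, Function.Injective x →
      stateMoment ν t x x = c := by
    by_cases h : ∃ x : Fin t → BitString n, Function.Injective x
    · obtain ⟨x₀, hx₀⟩ := h
      refine ⟨(stateMoment ν t x₀ x₀).re, fun x hx => ?_⟩
      rw [stateMoment_self_eq hν hx hx₀]
      exact Complex.eq_re_of_ofReal_le (r := 0) (by simpa using hpsd.diag_nonneg)
    · exact ⟨0, fun x hx => absurd ⟨x, hx⟩ h⟩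
  have hzero : ∀ x y : Fin t → BitString n, Function.Injective x →
      ¬ (Function.Injective y ∧ Set.range x = Set.range y) →
      stateMoment ν t x y = 0 ∧ stateMoment ν t y x = 0 := by
    intro x y hx h
    have h0 := stateMoment_apply_eq_zero hν hx h
    refine ⟨h0, ?_⟩
    rw [← hpsd.isHermitian.apply, h0, star_zero]
  refine ⟨c, ?_, ?_⟩
  -- The remainder is the compression of the moment to the non-injective tuples, hence positive
  -- semidefinite.
  · have h : stateMoment ν t - (c : ℂ) • permPattern n t =
        (diagonal fun x => if Function.Injective x then (0 : ℂ) else 1)ᴴ * stateMoment ν t *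
          (diagonal fun x => if Function.Injective x then (0 : ℂ) else 1) := by
      ext x y
      rw [diagonal_conjTranspose, mul_diagonal, diagonal_mul]
      simp only [Matrix.sub_apply, Matrix.smul_apply, permPattern, of_apply, Pi.star_apply,
        smul_eq_mul]
      by_cases hx : Function.Injective x
      · by_cases hy : Function.Injective y ∧ Set.range x = Set.range y
        · simp [hx, hy.1, hy.2, stateMoment_apply_of_range_eq hx hy.1 hy.2, hc x hx]
        · simp [hx, hy, (hzero x y hx hy).1]
      · by_cases hy : Function.Injective y
        · simp [hx, hy, (hzero y x hy fun h => hx h.1).2]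
        · simp [hx, hy]
    rw [h]
    exact hpsd.conjTranspose_mul_mul_same _
  · refine le_trans (le_of_eq ?_) (sum_injective_stateMoment_ge hν.norm_eq_one t)
    rw [trace, Complex.re_sum, Finset.mul_sum]
    congr 1
    refine Finset.sum_congr rfl fun x _ => ?_
    by_cases hx : Function.Injective x
    · simp [permPattern, hx, hc x hx]
    · simp [permPattern, hx]

theorem traceDist_stateMoment_le {ν₁ ν₂ : Measure (Ket n)} [IsProbabilityMeasure ν₁]
    [IsProbabilityMeasure ν₂] (h₁ : IsSignedPermInvariant ν₁) (h₂ : IsSignedPermInvariant ν₂)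
    (t : ℕ) {ε : ℝ} (he₁ : ∫ ψ, ∑ b, ‖ψ b‖ ^ 4 ∂ν₁ ≤ ε) (he₂ : ∫ ψ, ∑ b, ‖ψ b‖ ^ 4 ∂ν₂ ≤ ε) :
    traceDist (stateMoment ν₁ t) (stateMoment ν₂ t) ≤ (t : ℝ) ^ 2 * ε := by
  obtain ⟨c₁, hp₁, hc₁⟩ := exists_smul_permPattern h₁ t
  obtain ⟨c₂, hp₂, hc₂⟩ := exists_smul_permPattern h₂ t
  have hpsd := permPattern_posSemidef n t
  have hm₁ := stateMoment_posSemidef h₁.norm_eq_one t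
  have hm₂ := stateMoment_posSemidef h₂.norm_eq_one t
  have ht₁ := trace_stateMoment h₁.norm_eq_one t
  have ht₂ := trace_stateMoment h₂.norm_eq_one t
  set M₁ := stateMoment ν₁ t
  set M₂ := stateMoment ν₂ t
  set E := permPattern n t
  have hnn : ∀ r : ℝ, 0 ≤ r → ((r : ℂ) • E).PosSemidef := fun r hr =>
    hpsd.smul (Complex.zero_le_real.2 hr)
  have h2 : (0 : ℂ) ≤ 2 := by norm_num
  -- With `Rᵢ = Mᵢ - cᵢ • E`, the matrix `P ∓ (M₁ - M₂)` equals `(|c₁ - c₂| ∓ (c₁ - c₂)) • E` plus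
  -- `2 • R₂` or `2 • R₁` respectively.
  have key := traceNorm_le_trace
    (P := ((|c₁ - c₂| : ℝ) : ℂ) • E + (M₁ - (c₁ : ℂ) • E) + (M₂ - (c₂ : ℂ) • E))
    (hm₁.isHermitian.sub hm₂.isHermitian)
    (by
      convert (hnn (|c₁ - c₂| - (c₁ - c₂)) (sub_nonneg.2 (le_abs_self _))).add (hp₂.smul h2)
        using 1
      push_cast
      module)
    (by
      convert (hnn (|c₁ - c₂| + (c₁ - c₂)) (by linarith [neg_abs_le (c₁ - c₂)])).add (hp₁.smul h2)
        using 1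
      push_cast
      module)
  have hP : (((|c₁ - c₂| : ℝ) : ℂ) • E + (M₁ - (c₁ : ℂ) • E) + (M₂ - (c₂ : ℂ) • E)).trace.re =
      |c₁ - c₂| * E.trace.re + (1 - c₁ * E.trace.re) + (1 - c₂ * E.trace.re) := by
    simp only [trace_add, trace_sub, trace_smul, ht₁, ht₂, smul_eq_mul, Complex.add_re,
      Complex.sub_re, Complex.re_ofReal_mul, Complex.one_re]
  rw [hP] at key
  have hE : 0 ≤ E.trace.re := (Complex.le_def.1 hpsd.trace_nonneg).1
  have hq₁ : 1 - c₁ * E.trace.re ≤ (t : ℝ) ^ 2 * ε :=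
    hc₁.trans (mul_le_mul_of_nonneg_left he₁ (sq_nonneg _))
  have hq₂ : 1 - c₂ * E.trace.re ≤ (t : ℝ) ^ 2 * ε :=
    hc₂.trans (mul_le_mul_of_nonneg_left he₂ (sq_nonneg _))
  unfold traceDist
  -- In either case the trace of `P` collapses to twice the larger remainder trace, and the half in
  -- `traceDist` cancels the two.
  rcases le_total 0 (c₁ - c₂) with h | h
  · rw [abs_of_nonneg h] at key
    linarith
  · rw [abs_of_nonpos h] at key
    linarith

end InvariantLaw

/-! ### The law of subset phase states -/

section SubsetLaw

variable {n : ℕ}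

theorem subsetPhaseState_apply (f : BitString n → Bool) (S : Finset (BitString n))
    (x : BitString n) : subsetPhaseState f S x =
      if x ∈ S then (1 / (Real.sqrt (S.card : ℝ) : ℂ)) * (-1) ^ (f x).toNat else 0 := by
  have h : (∑ y ∈ S, ((-1 : ℂ) ^ (f y).toNat) • EuclideanSpace.single y (1 : ℂ)) x =
      if x ∈ S then (-1) ^ (f x).toNat else 0 := by
    rw [WithLp.ofLp_sum, Finset.sum_apply]
    simp
  rw [subsetPhaseState, PiLp.smul_apply, h]
  split_ifs <;> simp

theorem norm_subsetPhaseState_apply_sq (f : BitString n → Bool) (S : Finset (BitString n))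
    (x : BitString n) :
    ‖subsetPhaseState f S x‖ ^ 2 = if x ∈ S then 1 / (S.card : ℝ) else 0 := by
  rw [subsetPhaseState_apply]
  split_ifs
  · simp [Real.sq_sqrt]
  · simp

theorem norm_subsetPhaseState (f : BitString n → Bool) {S : Finset (BitString n)}
    (hS : S.Nonempty) : ‖subsetPhaseState f S‖ = 1 := by
  have h : ‖subsetPhaseState f S‖ ^ 2 = 1 := by
    have : (S.card : ℝ) ≠ 0 := by exact_mod_cast hS.card_pos.ne'
    rw [EuclideanSpace.norm_sq_eq]
    simp [norm_subsetPhaseState_apply_sq, this]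
  exact (pow_eq_one_iff_of_nonneg (norm_nonneg _) two_ne_zero).1 h

theorem sum_norm_pow_four_subsetPhaseState (f : BitString n → Bool) {S : Finset (BitString n)}
    (hS : S.Nonempty) : ∑ x, ‖subsetPhaseState f S x‖ ^ 4 = 1 / (S.card : ℝ) := by
  have h : ∀ x, ‖subsetPhaseState f S x‖ ^ 4 = if x ∈ S then (1 / (S.card : ℝ)) ^ 2 else 0 := by
    intro x
    rw [show 4 = 2 * 2 from rfl, pow_mul, norm_subsetPhaseState_apply_sq]
    split_ifs <;> simp
  have : (S.card : ℝ) ≠ 0 := by exact_mod_cast hS.card_pos.ne'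
  simp only [h, Finset.sum_ite_mem, Finset.univ_inter, Finset.sum_const, nsmul_eq_mul]
  field_simp

theorem signFlip_subsetPhaseState (b : BitString n) (f : BitString n → Bool)
    (S : Finset (BitString n)) : signFlip b (subsetPhaseState f S) =
      subsetPhaseState (fun x => if x = b then !f x else f x) S := by
  ext x
  rw [signFlip_apply, subsetPhaseState_apply, subsetPhaseState_apply]
  by_cases hb : x = b
  · subst hb
    by_cases hS : x ∈ S <;> cases f x <;> simp [hS]
  · simp [hb]

theorem permute_subsetPhaseState (e : Equiv.Perm (BitString n)) (f : BitString n → Bool)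
    (S : Finset (BitString n)) : permute e (subsetPhaseState f S) =
      subsetPhaseState (f ∘ e.symm) (S.map e.toEmbedding) := by
  ext x
  rw [permute_apply, subsetPhaseState_apply, subsetPhaseState_apply]
  simp [Finset.mem_map_equiv]

/-- The sample space of pairs `(S, f)` with `|S| = K`. -/
def phaseSamples (n K : ℕ) : Finset (Finset (BitString n) × (BitString n → Bool)) :=
  Finset.powersetCard K Finset.univ ×ˢ Finset.univ

theorem mem_phaseSamples {K : ℕ} {p : Finset (BitString n) × (BitString n → Bool)} :
    p ∈ phaseSamples n K ↔ p.1.card = K := by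
  simp [phaseSamples, Finset.mem_powersetCard]

theorem phaseSamples_nonempty {K : ℕ} (hK : K ≤ 2 ^ n) : (phaseSamples n K).Nonempty := by
  refine Finset.Nonempty.product (Finset.powersetCard_nonempty.2 ?_) Finset.univ_nonempty
  simpa using hK

/-- The law of a random subset phase state. -/
noncomputable def subsetPhaseLaw (n K : ℕ) : Measure (Ket n) :=
  ((phaseSamples n K).card : ENNReal)⁻¹ •
    ∑ p ∈ phaseSamples n K, Measure.dirac (subsetPhaseState p.2 p.1)

theorem isProbabilityMeasure_subsetPhaseLaw {K : ℕ} (hK : K ≤ 2 ^ n) :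
    IsProbabilityMeasure (subsetPhaseLaw n K) := by
  refine ⟨?_⟩
  have h0 : ((phaseSamples n K).card : ENNReal) ≠ 0 := by
    exact_mod_cast (phaseSamples_nonempty hK).card_pos.ne'
  simp only [subsetPhaseLaw, Measure.smul_apply, Measure.finsetSum_apply, measure_univ,
    Finset.sum_const, nsmul_eq_mul, mul_one, smul_eq_mul]
  exact ENNReal.inv_mul_cancel h0 (ENNReal.natCast_ne_top _)

theorem integral_subsetPhaseLaw {E : Type*} [NormedAddCommGroup E] [NormedSpace ℝ E]
    [CompleteSpace E] (K : ℕ) (g : Ket n → E) :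
    ∫ ψ, g ψ ∂(subsetPhaseLaw n K) = ((phaseSamples n K).card : ℝ)⁻¹ •
      ∑ p ∈ phaseSamples n K, g (subsetPhaseState p.2 p.1) := by
  rw [subsetPhaseLaw, integral_smul_measure, integral_finsetSum_measure]
  · simp
  · intro p _
    exact integrable_dirac (by finiteness)

/-- A map that acts on the states through a bijection of the sample space only reorders the sum of
Dirac masses. -/
theorem measurePreserving_subsetPhaseLaw {K : ℕ} {g : Ket n → Ket n} (hg : Measurable g)
    (σ : Equiv.Perm (Finset (BitString n) × (BitString n → Bool)))
    (hσ : ∀ p, p ∈ phaseSamples n K ↔ σ p ∈ phaseSamples n K)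
    (h : ∀ p, g (subsetPhaseState p.2 p.1) = subsetPhaseState (σ p).2 (σ p).1) :
    MeasurePreserving g (subsetPhaseLaw n K) (subsetPhaseLaw n K) := by
  refine ⟨hg, ?_⟩
  ext s hs
  rw [Measure.map_apply hg hs]
  simp only [subsetPhaseLaw, Measure.smul_apply, Measure.finsetSum_apply, smul_eq_mul]
  congr 1
  refine Finset.sum_equiv σ hσ fun p _ => ?_
  rw [← h, Measure.dirac_apply' _ (hg hs), Measure.dirac_apply' _ hs]
  rfl

theorem ae_subsetPhaseLaw {K : ℕ} {P : Ket n → Prop}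
    (hP : MeasurableSet {ψ | P ψ}) (h : ∀ p ∈ phaseSamples n K, P (subsetPhaseState p.2 p.1)) :
    ∀ᵐ ψ ∂(subsetPhaseLaw n K), P ψ := by
  rw [ae_iff]
  have hm : MeasurableSet {ψ | ¬ P ψ} := hP.compl
  simp only [subsetPhaseLaw, Measure.smul_apply, Measure.finsetSum_apply, smul_eq_mul]
  rw [Finset.sum_eq_zero, mul_zero]
  intro p hp
  rw [Measure.dirac_apply' _ hm]
  simp [h p hp]

/-- A sign change is absorbed by `f`, a basis permutation by transporting both `S` and `f`. -/
theorem isSignedPermInvariant_subsetPhaseLaw {K : ℕ} (hK0 : 0 < K) :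
    IsSignedPermInvariant (subsetPhaseLaw n K) where
  norm_eq_one := by
    refine ae_subsetPhaseLaw (measurableSet_eq_fun (by fun_prop) (by fun_prop)) fun p hp => ?_
    exact norm_subsetPhaseState _ (Finset.card_pos.1 (by rwa [mem_phaseSamples.1 hp]))
  signFlip b := by
    have hinv : Function.Involutive
        fun (f : BitString n → Bool) (x : BitString n) => if x = b then !f x else f x := by
      intro f
      ext x
      by_cases hx : x = b <;> simp [hx]
    refine measurePreserving_subsetPhaseLaw (signFlip b).continuous.measurable
      (Equiv.prodCongr (Equiv.refl _) hinv.toPerm) (fun p => ?_) fun p => ?_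
    · simp [mem_phaseSamples]
    · exact signFlip_subsetPhaseState b p.2 p.1
  permute e := by
    refine measurePreserving_subsetPhaseLaw (permute e).continuous.measurable
      (Equiv.prodCongr e.finsetCongr (e.arrowCongr (Equiv.refl _))) (fun p => ?_) fun p => ?_
    · simp [mem_phaseSamples]
    · exact permute_subsetPhaseState e p.2 p.1

theorem integral_sum_norm_pow_four_subsetPhaseLaw {K : ℕ} (hK0 : 0 < K) (hK : K ≤ 2 ^ n) :
    ∫ ψ, ∑ b, ‖ψ b‖ ^ 4 ∂(subsetPhaseLaw n K) = 1 / (K : ℝ) := by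
  have h : ∀ p ∈ phaseSamples n K, ∑ b, ‖subsetPhaseState p.2 p.1 b‖ ^ 4 = 1 / (K : ℝ) := by
    intro p hp
    have hc := mem_phaseSamples.1 hp
    rw [sum_norm_pow_four_subsetPhaseState _ (Finset.card_pos.1 (by rwa [hc])), hc]
  have h0 : ((phaseSamples n K).card : ℝ) ≠ 0 := by
    exact_mod_cast (phaseSamples_nonempty hK).card_pos.ne'
  rw [integral_subsetPhaseLaw, Finset.sum_congr rfl h, Finset.sum_const, nsmul_eq_mul, smul_eq_mul,
    inv_mul_cancel_left₀ h0]

theorem subsetPhaseMoment_eq_stateMoment (n t K : ℕ) :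
    subsetPhaseMoment n t K = stateMoment (subsetPhaseLaw n K) t := by
  have h : subsetPhaseMoment n t K = 𝔼 p ∈ phaseSamples n K,
      tensorPow t (ketBra (subsetPhaseState p.2 p.1)) :=
    (Finset.expect_product' _ _ fun S f => tensorPow t (ketBra (subsetPhaseState f S))).symm
  ext x y
  rw [h, Finset.expect, stateMoment, of_apply, integral_subsetPhaseLaw, Matrix.smul_apply,
    Matrix.sum_apply, NNRat.smul_def]
  simp

end SubsetLaw

/-! ### The Haar law and its fourth moments -/

section HaarLaw

open scoped Pointwise

variable {n : ℕ}

/-- The law of a Haar random state on the ambient space. -/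
noncomputable def haarLaw (n : ℕ) : Measure (Ket n) :=
  (haarState n).map Subtype.val

instance instIsProbabilityMeasureHaarLaw (n : ℕ) : IsProbabilityMeasure (haarLaw n) :=
  Measure.isProbabilityMeasure_map measurable_subtype_coe.aemeasurable

theorem haarMoment_eq_stateMoment (n t : ℕ) : haarMoment n t = stateMoment (haarLaw n) t := by
  ext x y
  simp only [haarMoment, stateMoment, of_apply, haarLaw]
  rw [integral_map measurable_subtype_coe.aemeasurable
    (continuous_tensorPow_ketBra x y).aestronglyMeasurable]

theorem ae_haarLaw_norm_eq_one : ∀ᵐ ψ ∂(haarLaw n), ‖ψ‖ = 1 := by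
  rw [haarLaw, ae_map_iff measurable_subtype_coe.aemeasurable
    (measurableSet_eq_fun (by fun_prop) (by fun_prop))]
  exact Filter.Eventually.of_forall fun φ => by simp

theorem haarLaw_apply {s : Set (Ket n)} (hs : MeasurableSet s) :
    haarLaw n s = ((volume : Measure (Ket n)).toSphere Set.univ)⁻¹ *
      (Module.finrank ℝ (Ket n) *
        volume (Set.Ioo (0 : ℝ) 1 • (Metric.sphere (0 : Ket n) 1 ∩ s))) := by
  rw [haarLaw, Measure.map_apply measurable_subtype_coe hs, haarState, Measure.smul_apply,
    smul_eq_mul, Measure.toSphere_apply' _ (measurable_subtype_coe hs),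
    Subtype.image_preimage_coe]

/-- Surface measure is proportional to the Lebesgue volume of the cone over a set; a linear isometry
commutes with forming cones and preserves volume. -/
theorem measurePreserving_haarLaw (U : Ket n ≃ₗᵢ[ℝ] Ket n) :
    MeasurePreserving U (haarLaw n) (haarLaw n) := by
  have hU : Measurable U := U.continuous.measurable
  refine ⟨hU, ?_⟩
  ext s hs
  rw [Measure.map_apply hU hs, haarLaw_apply hs, haarLaw_apply (hU hs)]
  have hset : Set.Ioo (0 : ℝ) 1 • (Metric.sphere (0 : Ket n) 1 ∩ U ⁻¹' s) =
      U ⁻¹' (Set.Ioo (0 : ℝ) 1 • (Metric.sphere (0 : Ket n) 1 ∩ s)) := by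
    ext ψ
    simp only [Set.mem_smul, Set.mem_preimage, Set.mem_inter_iff, mem_sphere_zero_iff_norm]
    constructor
    · rintro ⟨r, hr, φ, ⟨h1, h2⟩, rfl⟩
      exact ⟨r, hr, U φ, ⟨by simpa using h1, h2⟩, by simp⟩
    · rintro ⟨r, hr, φ, ⟨h1, h2⟩, h3⟩
      refine ⟨r, hr, U.symm φ, ⟨by simpa using h1, by simpa using h2⟩, ?_⟩
      rw [← map_smul, h3, U.symm_apply_apply]
  rw [hset, U.measurePreserving.measure_preimage_emb U.toHomeomorph.measurableEmbedding]

theorem isSignedPermInvariant_haarLaw : IsSignedPermInvariant (haarLaw n) where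
  norm_eq_one := ae_haarLaw_norm_eq_one
  signFlip _ := measurePreserving_haarLaw _
  permute _ := measurePreserving_haarLaw _

theorem norm_div_sqrt_two_sq (z : ℂ) : ‖z / (Real.sqrt 2 : ℂ)‖ ^ 2 = ‖z‖ ^ 2 / 2 := by
  rw [norm_div, div_pow, Complex.norm_real, Real.norm_eq_abs, sq_abs,
    Real.sq_sqrt zero_le_two]

/-- The action of a Hadamard gate on the plane of the basis states `a` and `b`. -/
noncomputable def planeHadamardMap (a b : BitString n) : Ket n →ₗ[ℝ] Ket n where
  toFun ψ := WithLp.toLp 2 fun x =>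
    if x = a then (ψ a + ψ b) / (Real.sqrt 2 : ℂ)
    else if x = b then (ψ a - ψ b) / (Real.sqrt 2 : ℂ) else ψ x
  map_add' ψ φ := by
    ext x
    simp only [PiLp.add_apply]
    split_ifs <;> ring
  map_smul' r ψ := by
    ext x
    simp only [PiLp.smul_apply, RingHom.id_apply, Complex.real_smul]
    split_ifs <;> ring

theorem planeHadamardMap_apply (a b : BitString n) (ψ : Ket n) (x : BitString n) :
    planeHadamardMap a b ψ x = if x = a then (ψ a + ψ b) / (Real.sqrt 2 : ℂ)
      else if x = b then (ψ a - ψ b) / (Real.sqrt 2 : ℂ) else ψ x := rfl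

theorem planeHadamardMap_involutive {a b : BitString n} (hab : a ≠ b) :
    Function.Involutive (planeHadamardMap a b) := by
  have h2 : (Real.sqrt 2 : ℂ) ^ 2 = 2 := by
    rw [← Complex.ofReal_pow, Real.sq_sqrt zero_le_two, Complex.ofReal_ofNat]
  have h0 : (Real.sqrt 2 : ℂ) ≠ 0 := fun h => by simp [h] at h2
  intro ψ
  ext x
  rw [planeHadamardMap_apply]
  simp only [planeHadamardMap_apply, hab.symm, if_true, if_false]
  split_ifs with h h
  · subst h
    field_simp
    rw [h2]
    ring
  · subst h
    field_simp
    rw [h2]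
    ring
  · rfl

theorem norm_planeHadamardMap {a b : BitString n} (hab : a ≠ b) (ψ : Ket n) :
    ‖planeHadamardMap a b ψ‖ = ‖ψ‖ := by
  rw [EuclideanSpace.norm_eq, EuclideanSpace.norm_eq]
  congr 1
  have h : ∀ x, ‖planeHadamardMap a b ψ x‖ ^ 2 = ‖ψ x‖ ^ 2 +
      ((if x = a then ‖ψ a + ψ b‖ ^ 2 / 2 - ‖ψ a‖ ^ 2 else 0) +
        (if x = b then ‖ψ a - ψ b‖ ^ 2 / 2 - ‖ψ b‖ ^ 2 else 0)) := by
    intro x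
    rw [planeHadamardMap_apply]
    by_cases hxa : x = a
    · subst hxa
      simp only [if_true, hab, if_false, norm_div_sqrt_two_sq]
      ring
    · by_cases hxb : x = b
      · subst hxb
        simp only [if_true, hxa, if_false, norm_div_sqrt_two_sq]
        ring
      · simp [hxa, hxb]
  simp only [h, Finset.sum_add_distrib, Finset.sum_ite_eq', Finset.mem_univ, if_true]
  linarith [parallelogram_law_with_norm ℝ (ψ a) (ψ b)]

/-- `planeHadamardMap` as an isometry. -/
noncomputable def planeHadamard {a b : BitString n} (hab : a ≠ b) : Ket n ≃ₗᵢ[ℝ] Ket n where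
  toLinearEquiv := LinearEquiv.ofInvolutive _ (planeHadamardMap_involutive hab)
  norm_map' := norm_planeHadamardMap hab

/-- With `X` and `Y` the two squared norms on the left, `X ^ 2 + Y ^ 2` is half of `(X + Y) ^ 2 + (X
- Y) ^ 2`; here `X + Y = ‖u‖ ^ 2 + ‖v‖ ^ 2` and `|X - Y| ≤ 2 * ‖u‖ * ‖v‖`. -/
theorem norm_pow_four_add_sub_le (u v : ℂ) :
    ‖(u + v) / (Real.sqrt 2 : ℂ)‖ ^ 4 + ‖(u - v) / (Real.sqrt 2 : ℂ)‖ ^ 4 ≤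
      (‖u‖ ^ 4 + ‖v‖ ^ 4) / 2 + 3 * (‖u‖ ^ 2 * ‖v‖ ^ 2) := by
  rw [show 4 = 2 * 2 from rfl, pow_mul, pow_mul, norm_div_sqrt_two_sq, norm_div_sqrt_two_sq,
    pow_mul, pow_mul]
  have hpar := parallelogram_law_with_norm ℝ u v
  have hp : ‖u + v‖ ^ 2 ≤ (‖u‖ + ‖v‖) ^ 2 := by gcongr; exact norm_add_le u v
  have hq : ‖u - v‖ ^ 2 ≤ (‖u‖ + ‖v‖) ^ 2 := by gcongr; exact norm_sub_le u v
  have habs : |‖u + v‖ ^ 2 - ‖u - v‖ ^ 2| ≤ 4 * (‖u‖ * ‖v‖) := by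
    rw [abs_le]
    constructor <;> nlinarith
  have hsq : (‖u + v‖ ^ 2 - ‖u - v‖ ^ 2) ^ 2 ≤ 16 * (‖u‖ ^ 2 * ‖v‖ ^ 2) := by
    have := sq_le_sq' (abs_le.1 habs).1 (abs_le.1 habs).2
    linarith
  have hsum : ‖u + v‖ ^ 2 + ‖u - v‖ ^ 2 = 2 * (‖u‖ ^ 2 + ‖v‖ ^ 2) := by linarith
  have hsum2 := congrArg (· ^ 2) hsum
  linarith

/-- Hadamard invariance turns the pointwise inequality into `A ≤ A / 2 + 3 * B` for the two sides'
integrals `A` and `B`, whence `A ≤ 6 * B`. -/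
theorem integral_norm_pow_four_add_le (a b : BitString n) :
    ∫ ψ, ‖ψ a‖ ^ 4 ∂(haarLaw n) + ∫ ψ, ‖ψ b‖ ^ 4 ∂(haarLaw n) ≤
      6 * ∫ ψ, ‖ψ a‖ ^ 2 * ‖ψ b‖ ^ 2 ∂(haarLaw n) := by
  have hI : ∀ f : Ket n → ℝ, Continuous f → Integrable f (haarLaw n) := fun f hf =>
    integrable_of_norm_eq_one ae_haarLaw_norm_eq_one hf
  have i₁ := hI (fun ψ => ‖ψ a‖ ^ 4) (by fun_prop)
  have i₂ := hI (fun ψ => ‖ψ b‖ ^ 4) (by fun_prop)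
  -- The diagonal case, where two is at most six, is kept so that the bound can be summed over all
  -- pairs.
  by_cases hab : a = b
  · subst hab
    have h : ∀ ψ : Ket n, ‖ψ a‖ ^ 2 * ‖ψ a‖ ^ 2 = ‖ψ a‖ ^ 4 := fun ψ => by ring
    have h0 : 0 ≤ ∫ ψ, ‖ψ a‖ ^ 4 ∂(haarLaw n) := integral_nonneg fun ψ => by positivity
    simp only [h]
    linarith
  · have hm := measurePreserving_haarLaw (planeHadamard hab)
    have hemb := (planeHadamard hab).toHomeomorph.measurableEmbedding
    have ha : ∫ ψ, ‖(ψ a + ψ b) / (Real.sqrt 2 : ℂ)‖ ^ 4 ∂(haarLaw n) =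
        ∫ ψ, ‖ψ a‖ ^ 4 ∂(haarLaw n) := by
      rw [← hm.integral_comp hemb fun ψ => ‖ψ a‖ ^ 4]
      congr 1
      ext ψ
      change _ = ‖planeHadamardMap a b ψ a‖ ^ 4
      rw [planeHadamardMap_apply, if_pos rfl]
    have hb : ∫ ψ, ‖(ψ a - ψ b) / (Real.sqrt 2 : ℂ)‖ ^ 4 ∂(haarLaw n) =
        ∫ ψ, ‖ψ b‖ ^ 4 ∂(haarLaw n) := by
      rw [← hm.integral_comp hemb fun ψ => ‖ψ b‖ ^ 4]
      congr 1
      ext ψ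
      change _ = ‖planeHadamardMap a b ψ b‖ ^ 4
      rw [planeHadamardMap_apply, if_neg (Ne.symm hab), if_pos rfl]
    have j₁ := hI (fun ψ => ‖(ψ a + ψ b) / (Real.sqrt 2 : ℂ)‖ ^ 4) (by fun_prop)
    have j₂ := hI (fun ψ => ‖(ψ a - ψ b) / (Real.sqrt 2 : ℂ)‖ ^ 4) (by fun_prop)
    have k := hI (fun ψ => ‖ψ a‖ ^ 2 * ‖ψ b‖ ^ 2) (by fun_prop)
    have hle := integral_mono (j₁.add j₂) (((i₁.add i₂).div_const 2).add (k.const_mul 3))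
      fun ψ => norm_pow_four_add_sub_le (ψ a) (ψ b)
    have hL := integral_add j₁ j₂
    have hR := integral_add ((i₁.add i₂).div_const 2) (k.const_mul 3)
    have hR1 := integral_div (μ := haarLaw n) (2 : ℝ) fun ψ : Ket n => ‖ψ a‖ ^ 4 + ‖ψ b‖ ^ 4
    have hR2 := integral_add i₁ i₂
    have hR3 := integral_const_mul (μ := haarLaw n) (3 : ℝ) fun ψ : Ket n =>
      ‖ψ a‖ ^ 2 * ‖ψ b‖ ^ 2
    simp only [Pi.add_apply] at hle hL hR hR1 hR2 hR3
    rw [hL, hR, hR1, hR2, hR3, ha, hb] at hle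
    linarith

/-- Summing the pair inequality over all `a` and `b` gives `2 * 2 ^ n` times the integral on the
left and `6` on the right, because the mixed moments sum to one. -/
theorem integral_sum_norm_pow_four_haarLaw_le (n : ℕ) :
    ∫ ψ, ∑ b, ‖ψ b‖ ^ 4 ∂(haarLaw n) ≤ 3 / (2 : ℝ) ^ n := by
  have hI : ∀ f : Ket n → ℝ, Continuous f → Integrable f (haarLaw n) := fun f hf =>
    integrable_of_norm_eq_one ae_haarLaw_norm_eq_one hf
  have hsum : ∫ ψ, ∑ b, ‖ψ b‖ ^ 4 ∂(haarLaw n) = ∑ b, ∫ ψ, ‖ψ b‖ ^ 4 ∂(haarLaw n) :=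
    integral_finsetSum _ fun b _ => hI _ (by fun_prop)
  have hone : ∑ a, ∑ b, ∫ ψ, ‖ψ a‖ ^ 2 * ‖ψ b‖ ^ 2 ∂(haarLaw n) = 1 := by
    have h1 : ∫ ψ, ∑ a, ∑ b, ‖ψ a‖ ^ 2 * ‖ψ b‖ ^ 2 ∂(haarLaw n) = 1 := by
      have h : ∀ᵐ ψ ∂(haarLaw n), ∑ a, ∑ b, ‖ψ a‖ ^ 2 * ‖ψ b‖ ^ 2 = (1 : ℝ) := by
        filter_upwards [ae_haarLaw_norm_eq_one] with ψ hψ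
        rw [← Finset.sum_mul_sum, sum_norm_sq hψ, one_mul]
      rw [integral_congr_ae h]
      simp
    rw [← h1, integral_finsetSum _ fun a _ => hI _ (by fun_prop)]
    exact Finset.sum_congr rfl fun a _ =>
      (integral_finsetSum _ fun b _ => hI _ (by fun_prop)).symm
  have hle := Finset.sum_le_sum fun a (_ : a ∈ (Finset.univ : Finset (BitString n))) =>
    Finset.sum_le_sum fun b (_ : b ∈ (Finset.univ : Finset (BitString n))) =>
      integral_norm_pow_four_add_le a b
  simp only [Finset.sum_add_distrib, ← Finset.mul_sum, hone, Finset.sum_const, nsmul_eq_mul,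
    ← hsum] at hle
  have hcard : ((Finset.univ : Finset (BitString n)).card : ℝ) = 2 ^ n := by simp
  rw [hcard] at hle
  rw [le_div_iff₀ (by positivity)]
  linarith

end HaarLaw

/-! ### The quantitative bound and its asymptotic consequence -/

theorem traceDist_subsetPhaseMoment_haarMoment_le {n t K : ℕ} (htK : t < K) (hK : K ≤ 2 ^ n) :
    traceDist (subsetPhaseMoment n t K) (haarMoment n t) ≤ 3 * ((t : ℝ) ^ 2 / (K : ℝ)) := by
  have hK0 : 0 < K := (Nat.zero_le t).trans_lt htK
  have hK0' : (0 : ℝ) < K := by exact_mod_cast hK0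
  have := isProbabilityMeasure_subsetPhaseLaw hK
  rw [subsetPhaseMoment_eq_stateMoment, haarMoment_eq_stateMoment]
  refine (traceDist_stateMoment_le (isSignedPermInvariant_subsetPhaseLaw hK0)
    isSignedPermInvariant_haarLaw t (ε := 3 / K) ?_ ?_).trans (le_of_eq (by ring))
  · rw [integral_sum_norm_pow_four_subsetPhaseLaw hK0 hK]
    gcongr
    norm_num
  · refine (integral_sum_norm_pow_four_haarLaw_le n).trans ?_
    gcongr
    exact_mod_cast hK

theorem eventually_pow_le_of_log_isLittleO {K : ℕ → ℕ}
    (h : (fun n : ℕ => Real.log (n : ℝ)) =o[Filter.atTop] fun n : ℕ => Real.logb 2 (K n : ℝ))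
    (m : ℕ) : ∀ᶠ n : ℕ in Filter.atTop, (n : ℝ) ^ m ≤ K n := by
  have hl2 : 0 < Real.log 2 := Real.log_pos one_lt_two
  -- The factor `Real.log 2` undoes the base of `logb`; dividing by `m + 1` rather than `m` keeps
  -- the constant valid at `m = 0`.
  filter_upwards [h.bound (show 0 < Real.log 2 / (m + 1) by positivity),
    Filter.eventually_ge_atTop 2] with n hn hn2
  have hn2' : (2 : ℝ) ≤ n := by exact_mod_cast hn2
  have hlog : 0 < Real.log n := Real.log_pos (by linarith)
  have hlK : 0 ≤ Real.log (K n) := Real.log_natCast_nonneg _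
  rw [Real.norm_eq_abs, Real.norm_eq_abs, abs_of_pos hlog, Real.logb,
    abs_of_nonneg (by positivity)] at hn
  have hn' : (m + 1) * Real.log n ≤ Real.log (K n) := by
    have : Real.log 2 / (m + 1) * (Real.log (K n) / Real.log 2) = Real.log (K n) / (m + 1) := by
      field_simp
    rw [this, le_div_iff₀ (by positivity)] at hn
    linarith
  -- If `K n` were zero, its logarithm would be zero by convention, below the positive left side of
  -- `hn'`.
  have hK0 : (0 : ℝ) < K n := by
    rcases Nat.eq_zero_or_pos (K n) with h0 | h0
    · rw [h0, Nat.cast_zero, Real.log_zero] at hn'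
      have : 0 < (m + 1) * Real.log n := by positivity
      linarith
    · exact_mod_cast h0
  rw [← Real.log_le_log_iff (by positivity) hK0, Real.log_pow]
  linarith

theorem eventually_eval_le_pow (p : Polynomial ℝ) :
    ∃ d : ℕ, ∀ᶠ n : ℕ in Filter.atTop, p.eval (n : ℝ) ≤ (n : ℝ) ^ d := by
  -- One degree more than `p` makes the quotient tend to zero, whatever the leading coefficient.
  refine ⟨p.natDegree + 1, ?_⟩
  have hdeg : p.degree < (Polynomial.X ^ (p.natDegree + 1) : Polynomial ℝ).degree := by
    rw [Polynomial.degree_X_pow]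
    exact Polynomial.degree_le_natDegree.trans_lt (by exact_mod_cast Nat.lt_succ_self _)
  have h := (Polynomial.div_tendsto_atTop_zero_of_degree_lt _ _ hdeg).comp
    tendsto_natCast_atTop_atTop
  filter_upwards [h.eventually (gt_mem_nhds zero_lt_one), Filter.eventually_gt_atTop 0]
    with n hn hn0
  have hn0' : (0 : ℝ) < n := by exact_mod_cast hn0
  simp only [Function.comp_apply, Polynomial.eval_pow, Polynomial.eval_X] at hn
  rw [div_lt_one (by positivity)] at hn
  exact hn.le

end SubsetPhase

theorem theorem3p1 :
    (∃ C : ℝ, 0 < C ∧ ∀ n t K : ℕ, t < K → K ≤ 2 ^ n →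
      SubsetPhase.traceDist (SubsetPhase.subsetPhaseMoment n t K) (SubsetPhase.haarMoment n t)
        ≤ C * ((t : ℝ) ^ 2 / (K : ℝ))) ∧
    (∀ K t : ℕ → ℕ,
      (∀ᶠ n in Filter.atTop, K n ≤ 2 ^ n) →
      -- `K = 2 ^ ω(log n)`
      ((fun n : ℕ => Real.log (n : ℝ)) =o[Filter.atTop] fun n : ℕ => Real.logb 2 (K n : ℝ)) →
      -- `t` is polynomially bounded
      (∃ p : Polynomial ℝ, ∀ᶠ n : ℕ in Filter.atTop, (t n : ℝ) ≤ p.eval (n : ℝ)) →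
      ∀ q : Polynomial ℝ, (∀ᶠ n : ℕ in Filter.atTop, 0 < q.eval (n : ℝ)) →
        ∀ᶠ n : ℕ in Filter.atTop,
          SubsetPhase.traceDist (SubsetPhase.subsetPhaseMoment n (t n) (K n))
              (SubsetPhase.haarMoment n (t n))
            < 1 / q.eval (n : ℝ)) := by
  refine ⟨⟨3, by norm_num, fun n t K htK hK =>
    SubsetPhase.traceDist_subsetPhaseMoment_haarMoment_le htK hK⟩, ?_⟩
  rintro K t hK hlog ⟨p, hp⟩ q hq
  obtain ⟨d, hd⟩ := SubsetPhase.eventually_eval_le_pow p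
  obtain ⟨e, he⟩ := SubsetPhase.eventually_eval_le_pow q
  -- `t ^ 2 * q` is at most `n ^ (2 * d + e)`; the extra power of `n`, with `n > 3`, beats the
  -- constant `3` and also forces `t n < K n`.
  filter_upwards [hK, hp, hq, hd, he,
    SubsetPhase.eventually_pow_le_of_log_isLittleO hlog (2 * d + e + 1),
    Filter.eventually_gt_atTop 3] with n hKn hpn hqn hdn hen hKm hn
  have hn3 : (3 : ℝ) < n := by exact_mod_cast hn
  have hn1 : (1 : ℝ) < n := by linarith
  have htd : (t n : ℝ) ≤ (n : ℝ) ^ d := hpn.trans hdn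
  have htK : t n < K n := by
    have : (t n : ℝ) < K n := (htd.trans_lt (pow_lt_pow_right₀ hn1 (by omega))).trans_le hKm
    exact_mod_cast this
  have hK0 : (0 : ℝ) < K n := by exact_mod_cast (Nat.zero_le _).trans_lt htK
  refine (SubsetPhase.traceDist_subsetPhaseMoment_haarMoment_le htK hKn).trans_lt ?_
  rw [← mul_div_assoc, div_lt_div_iff₀ hK0 hqn, one_mul]
  calc 3 * (t n : ℝ) ^ 2 * q.eval (n : ℝ) ≤ 3 * ((n : ℝ) ^ d) ^ 2 * (n : ℝ) ^ e := by gcongr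
    _ = 3 * (n : ℝ) ^ (2 * d + e) := by ring
    _ < n * (n : ℝ) ^ (2 * d + e) := by gcongr
    _ = (n : ℝ) ^ (2 * d + e + 1) := by ring
    _ ≤ K n := hKm
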